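/- Fix integers $d\ge 1$, $i\ge 1$ and a real number $T>0$. For $n\ge 2$, balls are placed one after another into $n$ initially empty bins labelled $0,1,\dots,n-1$ by double hashing with $d$ choices: the $j$th ball has hash values $f(j)$, uniform on $\{0,\dots,n-1\}$, and $g(j)$, uniform on the numbers in $\{1,\dots,n-1\}$ that are relatively prime to $n$, all hash values being independent. The choices of the ball are the bins $f(j)+k\,g(j) \bmod n$ for $k=0,\dots,d-1$, and the ball is placed in a least loaded one of them, ties being broken uniformly at random (independently for each ball, by a uniformly random ranking of its $d$ choices). Let $X_r(t)$ be the number of bins of load at least $r$ after $tn$ balls have been placed, and let $x_r(t)=X_r(t)/n$. Let $\mathcal H_m$ be the $\sigma$-algebra generated by the hash values and the tie-breaking rankings of the first $m$ balls. Then there are sequences $\varepsilon_n\to 0$ and $\delta_n\to 0$, depending only on $d$, $i$ and $T$, such that for every $n\ge 2$, with probability at least $1-\delta_n$, simultaneously for all integers $m$ with $0\le m\le Tn$, writing $t=m/n$, $$\Bigl|\,\mathbb E\bigl[X_i(t+1/n)-X_i(t)\,\big|\,\mathcal H_{m}\bigr]-\bigl(x_{i-1}(t)^d-x_i(t)^d\bigr)\Bigr|\le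 \varepsilon_n .$$ -/

import Mathlib

open MeasureTheory ProbabilityTheory Filter Topology

noncomputable section

namespace DoubleHashing

/-- The random data of one ball, for `n` bins (labelled by `ZMod n`) and `d` choices: the first hash
value `start` in `{0, …, n - 1}`, the second hash value `stride`, a residue coprime to `n` (for
`2 ≤ n` these are the numbers in `{1, …, n - 1}` coprime to `n`), and a ranking of the `d` choices
that is used only to break ties. -/
@[ext]
structure Probe (n d : ℕ) where
  start : ZMod n
  stride : (ZMod n)ˣ
  rank : Equiv.Perm (Fin d)

instance (n d : ℕ) : MeasurableSpace (Probe n d) := ⊤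

/-- The `k`-th choice `f + k g mod n` of a ball with hash values `f` and `g`. -/
def Probe.bin {n d : ℕ} (c : Probe n d) (k : Fin d) : ZMod n :=
  c.start + (k : ℕ) * (c.stride : ZMod n)

/-- With current loads `L`, the ball goes to its `k`-th choice: that choice is a least loaded one
among the `d` choices, and it has the smallest rank among the least loaded ones. For a uniformly
random ranking this is a uniformly random choice among the tied least loaded ones. -/
def Probe.Selects {n d : ℕ} (c : Probe n d) (L : ZMod n → ℕ) (k : Fin d) : Prop :=
  ∀ l : Fin d, L (c.bin k) < L (c.bin l) ∨ (L (c.bin k) = L (c.bin l) ∧ c.rank k ≤ c.rank l)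

open Classical in
/-- The loads after one more ball, with data `c`, has been placed. -/
def place {n d : ℕ} (L : ZMod n → ℕ) (c : Probe n d) : ZMod n → ℕ :=
  fun b => L b + if ∃ k : Fin d, c.bin k = b ∧ c.Selects L k then 1 else 0

/-- The loads after the first `m` balls have been placed into initially empty bins. -/
def load {n d : ℕ} (c : ℕ → Probe n d) : ℕ → ZMod n → ℕ
  | 0 => fun _ => 0
  | m + 1 => place (load c m) (c m)

/-- `X_i` after `m` balls: the number of bins of load at least `i`. -/
def tailCount {n d : ℕ} (c : ℕ → Probe n d) (i m : ℕ) : ℝ :=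
  ({b : ZMod n | i ≤ load c m b}.ncard : ℝ)

/-- `x_i = X_i / n` after `m` balls: the fraction of bins of load at least `i`. -/
def tailFrac {n d : ℕ} (c : ℕ → Probe n d) (i m : ℕ) : ℝ :=
  tailCount c i m / n

/-- The balls' data are independent, and those of each ball are uniformly distributed (so the two
hash values and the tie-breaking ranking of a ball are uniform and independent too). -/
structure IsDoubleHashing {Ω : Type*} [MeasurableSpace Ω] (μ : Measure Ω) {n d : ℕ}
    (ball : ℕ → Ω → Probe n d) : Prop where
  measurable : ∀ j, Measurable (ball j)
  indep : iIndepFun ball μ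
  uniform : ∀ j, μ.map (ball j) = uniformOn Set.univ

/-- The history of the process up to and including the first `m` balls. -/
abbrev history {Ω : Type*} {n d : ℕ} (ball : ℕ → Ω → Probe n d) (m : ℕ) : MeasurableSpace Ω :=
  ⨆ j : ℕ, ⨆ _ : j < m, MeasurableSpace.comap (ball j) inferInstance

end DoubleHashing

end

/-!
The load vectors form a Markov chain, and `step d` is its transition operator. Given the history,
the expected growth of the number of bins of load at least `i` is exactly
`Ψ (i - 1) - Ψ i`, where `Ψ r = allChoicesTail d r` is the probability that all choices of a random
ball have load at least `r` (`step_numTail_sub`). It has to be shown that `Ψ r` is close to the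
`d`-th power of the fraction `x r = fracTail r` of bins of load at least `r`, uniformly in time.

The main tool is a coupling (`place_add_single`): if two load vectors differ by one surplus ball,
they still do after the same further ball has been placed in both, and the surplus ball has moved
at most from one choice of this ball to another one. Since a double-hashing ball hits two given
distinct bins with probability at most `O(1 / (n φ(n)))` (`expect_bin_pair_le`), a surplus ball in
bin `z` affects the final load of a given other bin with probability `O(1 / φ(n))` only, and the sum
of these probabilities over all `z` is bounded (`IncrementLE.step_pow`). The covariance of two
functionals of the final loads is the sum over the balls of the covariances that the single balls
produce, each being controlled by these influences (`abs_step_pow_mul_sub_le`,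
`IncrementLE.abs_step_mul_sub_le`). This has two consequences.

* Loads of disjoint bounded sets of bins have covariance `O(1 / φ(n))` (`abs_cov_allTail_le`), so
  the `d` choices of a ball, which are distinct for `d ≤ n`, have asymptotically independent loads.
  By translation invariance all bins have the same load distribution; hence the mean of `Ψ r` is
  close to the `d`-th power of the mean of `x r` (`abs_step_pow_allChoicesTail_sub_le`).
* `Ψ r` and `x r` change by `O(1 / n)` when one ball is added, so their variances are `O(1 / n)`
  (`IncrementLE.step_pow_sq_sub_le`).

Together the second moment of `Ψ r - x r ^ d` is `O(1 / φ(n))` at every time up to order `n`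
(`step_pow_meanFieldError_sq_le`). Since one ball changes this quantity by `O(1 / n)` only, a value
above `2 λ` at some time forces values above `λ` during a window of order `λ n`. Markov's inequality
for the sum of squares over all times bounds the probability of this by `O(1 / (φ(n) λ ^ 3))`
(`IsDoubleHashing.measureReal_lt_le`), and `λ = φ(n) ^ (-1 / 4)` works because `φ(n) → ∞`
(`tendsto_totient_atTop`).
-/

noncomputable section

namespace DoubleHashing

open Finset
open scoped BigOperators

variable {n d : ℕ}

/-! ### Growth of the totient function -/

/-- The factor `2` is needed only for even `n`, so that in a product of coprime numbers it occurs
at most once; this is what makes the induction over coprime factors work. -/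
theorem le_two_mul_totient_sq (n : ℕ) :
    (Odd n → n ≤ n.totient ^ 2) ∧ n ≤ 2 * n.totient ^ 2 := by
  induction n using Nat.recOnPosPrimePosCoprime with
  | zero => simp
  | one => simp
  | prime_pow p k hp hk =>
    obtain ⟨k, rfl⟩ : ∃ j, k = j + 1 := ⟨k - 1, by omega⟩
    rw [Nat.totient_prime_pow_succ hp]
    have hp2 := hp.two_le
    obtain ⟨q, rfl⟩ : ∃ q, p = q + 2 := ⟨p - 2, by omega⟩
    have hpos : 1 ≤ (q + 2) ^ k := Nat.one_le_pow _ _ (by omega)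
    have e : q + 2 - 1 = q + 1 := by omega
    rw [e]
    have key : (q + 2) ^ k * ((q + 1) ^ 2) ≤ ((q + 2) ^ k * (q + 1)) ^ 2 := by
      nlinarith [Nat.mul_le_mul hpos (le_refl ((q + 2) ^ k * (q + 1) ^ 2))]
    refine ⟨fun hodd => ?_, ?_⟩
    · have hq : 1 ≤ q := by
        rcases Nat.eq_zero_or_pos q with rfl | h
        · rw [Nat.odd_pow_iff (by omega)] at hodd
          exact absurd hodd (by decide)
        · exact h
      calc (q + 2) ^ (k + 1) = (q + 2) ^ k * (q + 2) := pow_succ _ _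
        _ ≤ (q + 2) ^ k * ((q + 1) ^ 2) := Nat.mul_le_mul_left _ (by nlinarith)
        _ ≤ _ := key
    · calc (q + 2) ^ (k + 1) = (q + 2) ^ k * (q + 2) := pow_succ _ _
        _ ≤ (q + 2) ^ k * (2 * (q + 1) ^ 2) := Nat.mul_le_mul_left _ (by nlinarith)
        _ = 2 * ((q + 2) ^ k * ((q + 1) ^ 2)) := by ring
        _ ≤ _ := Nat.mul_le_mul_left _ key
  | coprime a b ha hb hab iha ihb =>
    rw [Nat.totient_mul hab, mul_pow]
    refine ⟨fun hodd => ?_, ?_⟩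
    · rw [Nat.odd_mul] at hodd
      exact Nat.mul_le_mul (iha.1 hodd.1) (ihb.1 hodd.2)
    · rcases Nat.even_or_odd a with hae | hao
      · have hbo : Odd b := by
          rw [← Nat.not_even_iff_odd]
          intro hbe
          have := Nat.dvd_gcd hae.two_dvd hbe.two_dvd
          rw [hab] at this
          omega
        calc a * b ≤ (2 * a.totient ^ 2) * b.totient ^ 2 := Nat.mul_le_mul iha.2 (ihb.1 hbo)
          _ = _ := by ring
      · calc a * b ≤ a.totient ^ 2 * (2 * b.totient ^ 2) := Nat.mul_le_mul (iha.1 hao) ihb.2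
          _ = _ := by ring

theorem tendsto_totient_atTop : Tendsto Nat.totient atTop atTop := by
  refine tendsto_atTop.2 fun b => ?_
  filter_upwards [eventually_ge_atTop (2 * b ^ 2)] with n hn
  have h := (le_two_mul_totient_sq n).2
  by_contra! hlt
  have : n.totient ^ 2 < b ^ 2 := Nat.pow_lt_pow_left hlt (by norm_num)
  omega

/-! ### Uniformly random probes -/

/-- A probe is determined by its `k`-th choice, its stride and its ranking, and these can be
prescribed arbitrarily. -/
def Probe.binEquiv (k : Fin d) :
    Probe n d ≃ ZMod n × ((ZMod n)ˣ × Equiv.Perm (Fin d)) where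
  toFun c := (c.bin k, c.stride, c.rank)
  invFun x := ⟨x.1 - (k : ℕ) * (x.2.1 : ZMod n), x.2.1, x.2.2⟩
  left_inv c := by ext <;> simp [Probe.bin]
  right_inv x := by ext <;> simp [Probe.bin]

/-- A probe as the triple of its fields. -/
def Probe.prodEquiv : Probe n d ≃ ZMod n × ((ZMod n)ˣ × Equiv.Perm (Fin d)) where
  toFun c := (c.start, c.stride, c.rank)
  invFun x := ⟨x.1, x.2.1, x.2.2⟩
  left_inv _ := rfl
  right_inv _ := rfl

instance [NeZero n] : Fintype (Probe n d) := Fintype.ofEquiv _ Probe.prodEquiv.symm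

instance : Nonempty (Probe n d) := ⟨⟨0, 1, 1⟩⟩

instance : DiscreteMeasurableSpace (Probe n d) := ⟨fun _ => trivial⟩

/-- Each choice of a uniformly random probe is a uniformly random bin. -/
theorem expect_bin [NeZero n] (k : Fin d) (w : ZMod n → ℝ) :
    𝔼 c : Probe n d, w (c.bin k) = (∑ z, w z) / n := by
  rw [Fintype.expect_equiv (Probe.binEquiv k) (fun c => w (c.bin k)) (fun x => w x.1)
    (fun _ => rfl), ← univ_product_univ, expect_product]
  simp [Fintype.expect_eq_sum_div_card, ZMod.card]

theorem expect_sum_bin [NeZero n] (w : ZMod n → ℝ) :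
    𝔼 c : Probe n d, ∑ k, w (c.bin k) = d / n * ∑ z, w z := by
  rw [expect_sum_comm]
  simp only [expect_bin, sum_const, card_univ, Fintype.card_fin, nsmul_eq_mul]
  ring

/-- In the cyclic group `ZMod n` the equation `j g = t` has at most `j` solutions. -/
theorem card_mul_eq_le [NeZero n] (j : ℕ) (hj : 0 < j) (t : ZMod n) :
    #{g : ZMod n | (j : ZMod n) * g = t} ≤ j := by
  rcases ({g : ZMod n | (j : ZMod n) * g = t} : Finset (ZMod n)).eq_empty_or_nonempty with h | h
  · simp [h]
  obtain ⟨g₀, hg₀⟩ := h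
  simp only [mem_filter, mem_univ, true_and] at hg₀
  refine le_trans ?_ (IsAddCyclic.card_nsmul_eq_zero_le (α := ZMod n) hj)
  refine card_le_card_of_injOn (fun g => g - g₀) (fun g hg => ?_)
    (fun a _ b _ h => by simpa using h)
  simp only [coe_filter, mem_univ, true_and, Set.mem_ofPred_eq] at hg ⊢
  rw [nsmul_eq_mul, mul_sub, hg, hg₀, sub_self]

theorem card_stride_le [NeZero n] (k l : Fin d) {t : ZMod n} (ht : t ≠ 0) :
    #{g : (ZMod n)ˣ | (l : ℕ) * (g : ZMod n) - (k : ℕ) * (g : ZMod n) = t} ≤ d := by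
  have aux : ∀ (j : ℕ) (s : ZMod n), 0 < j → j ≤ d →
      ({g : (ZMod n)ˣ | (l : ℕ) * (g : ZMod n) - (k : ℕ) * (g : ZMod n) = t} : Finset _).map
        ⟨fun g : (ZMod n)ˣ => (g : ZMod n), Units.val_injective⟩ ⊆
        ({g : ZMod n | (j : ZMod n) * g = s} : Finset _) →
      #{g : (ZMod n)ˣ | (l : ℕ) * (g : ZMod n) - (k : ℕ) * (g : ZMod n) = t} ≤ d := by
    intro j s h0 hjd h
    have := (card_le_card h).trans (card_mul_eq_le j h0 s)
    rw [card_map] at this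
    exact this.trans hjd
  rcases lt_trichotomy (k : ℕ) l with h | h | h
  · refine aux (l - k) t (by omega) (by omega) fun g hg => ?_
    simp only [Finset.mem_map, mem_filter, mem_univ, true_and] at hg ⊢
    obtain ⟨g, hg, rfl⟩ := hg
    dsimp only [Function.Embedding.coeFn_mk]
    rw [Nat.cast_sub h.le, sub_mul, hg]
  · simp [h, ht.symm]
  · refine aux (k - l) (-t) (by omega) (by omega) fun g hg => ?_
    simp only [Finset.mem_map, mem_filter, mem_univ, true_and] at hg ⊢
    obtain ⟨g, hg, rfl⟩ := hg
    dsimp only [Function.Embedding.coeFn_mk]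
    rw [Nat.cast_sub h.le, sub_mul, ← hg]
    ring

/-- Two prescribed distinct bins are rarely both hit by a double-hashing probe: the stride is
determined up to at most `d` possibilities, and then so is the start. -/
theorem expect_bin_pair_le [NeZero n] (k l : Fin d) {z z' : ZMod n} (hz : z ≠ z') :
    𝔼 c : Probe n d, (if c.bin k = z ∧ c.bin l = z' then (1 : ℝ) else 0)
      ≤ d / (n * n.totient) := by
  let a : ZMod n → ℝ := fun x => if x = z then 1 else 0
  let b : (ZMod n)ˣ → ℝ := fun g =>
    if (l : ℕ) * (g : ZMod n) - (k : ℕ) * (g : ZMod n) = z' - z then 1 else 0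
  have key : ∀ c : Probe n d, (if c.bin k = z ∧ c.bin l = z' then (1 : ℝ) else 0) =
      (fun x => a x.1 * b x.2.1) (Probe.binEquiv k c) := by
    intro c
    simp only [a, b, Probe.binEquiv, Equiv.coe_fn_mk]
    rw [ite_zero_mul_ite_zero, mul_one]
    refine if_congr (and_congr_right fun h => ?_) rfl rfl
    subst h
    simp only [Probe.bin]
    constructor
    · rintro rfl; ring
    · intro h
      linear_combination h
  rw [Fintype.expect_equiv (Probe.binEquiv k) _ (fun x => a x.1 * b x.2.1) key,
    ← univ_product_univ, expect_product]
  dsimp only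
  rw [← expect_mul_expect univ univ a fun x : (ZMod n)ˣ × Equiv.Perm (Fin d) => b x.1,
    ← univ_product_univ, expect_product]
  simp only [Fintype.expect_const, a, b]
  simp only [Fintype.expect_eq_sum_div_card, sum_boole, ZMod.card,
    ZMod.card_units_eq_totient]
  have h1 : ((#{x : ZMod n | x = z} : ℕ) : ℝ) = 1 := by simp [filter_eq']
  have h2 := card_stride_le k l (sub_ne_zero.2 hz.symm)
  rw [h1, div_mul_div_comm, one_mul]
  gcongr

/-! ### Placing one ball -/

theorem exists_selects (hd : 1 ≤ d) (c : Probe n d) (L : ZMod n → ℕ) : ∃ k, c.Selects L k := by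
  have : Nonempty (Fin d) := ⟨⟨0, hd⟩⟩
  obtain ⟨k, hk⟩ := Finite.exists_min fun k : Fin d => toLex (L (c.bin k), c.rank k)
  refine ⟨k, fun l => ?_⟩
  simpa [Prod.Lex.toLex_le_toLex] using hk l

theorem Probe.Selects.eq {c : Probe n d} {L : ZMod n → ℕ} {k l : Fin d} (hk : c.Selects L k)
    (hl : c.Selects L l) : k = l := by
  have h1 := hk l
  have h2 := hl k
  exact c.rank.injective (le_antisymm (by omega) (by omega))

theorem Probe.Selects.place_eq {c : Probe n d} {L : ZMod n → ℕ} {k : Fin d}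
    (hk : c.Selects L k) : place L c = L + Pi.single (c.bin k) 1 := by
  classical
  funext b
  simp only [place, Pi.add_apply, Pi.single_apply]
  congr 1
  refine if_congr ⟨?_, ?_⟩ rfl rfl
  · rintro ⟨l, rfl, hl⟩
    rw [hk.eq hl]
  · rintro rfl
    exact ⟨k, rfl, hk⟩

theorem Probe.Selects.le {c : Probe n d} {L : ZMod n → ℕ} {k : Fin d} (hk : c.Selects L k)
    (l : Fin d) : L (c.bin k) ≤ L (c.bin l) := by
  have := hk l
  omega

/-- A surplus ball in bin `z` still makes up the whole difference after one more ball has been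
placed; it has moved at most from one choice of this ball to another one. -/
theorem place_add_single (hd : 1 ≤ d) (c : Probe n d) (L : ZMod n → ℕ) (z : ZMod n) :
    ∃ z', place (L + Pi.single z 1) c = place L c + Pi.single z' 1 ∧
      (z' = z ∨ ∃ k l, c.bin k = z ∧ c.bin l = z' ∧ z ≠ z') := by
  obtain ⟨k, hk⟩ := exists_selects hd c L
  obtain ⟨l, hl⟩ := exists_selects hd c (L + Pi.single z 1)
  by_cases hz : c.bin k = z
  · refine ⟨c.bin l, ?_, ?_⟩
    · rw [hl.place_eq, hk.place_eq, hz]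
    · by_cases h : c.bin l = z
      · exact Or.inl h
      · exact Or.inr ⟨k, l, hz, rfl, fun h' => h h'.symm⟩
  · refine ⟨z, ?_, Or.inl rfl⟩
    -- A higher load in `z` makes `z` less attractive, so a ball that avoided `z` still does.
    have hk' : c.Selects (L + Pi.single z 1) k := by
      intro j
      have := hk j
      simp only [Pi.add_apply, Pi.single_apply, if_neg hz]
      split_ifs <;> omega
    rw [hk'.place_eq, hk.place_eq, add_right_comm]

theorem place_translate (L : ZMod n → ℕ) (c : Probe n d) (t : ZMod n) :
    place (fun b => L (b + t)) c =
      fun b => place L ⟨c.start + t, c.stride, c.rank⟩ (b + t) := by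
  classical
  funext b
  have hbin : ∀ k, (⟨c.start + t, c.stride, c.rank⟩ : Probe n d).bin k = c.bin k + t := by
    intro k
    simp only [Probe.bin]
    ring
  refine congrArg (L (b + t) + ·) (if_congr ?_ rfl rfl)
  simp only [Probe.Selects, hbin, add_left_inj]

/-! ### The one-step averaging operator and the influence of a surplus ball -/

/-- `w z` bounds the change of `φ` caused by one surplus ball in bin `z`. -/
def IncrementLE (φ : (ZMod n → ℕ) → ℝ) (w : ZMod n → ℝ) : Prop :=
  ∀ L z, |φ (L + Pi.single z 1) - φ L| ≤ w z

theorem IncrementLE.nonneg {φ : (ZMod n → ℕ) → ℝ} {w : ZMod n → ℝ} (h : IncrementLE φ w)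
    (z : ZMod n) : 0 ≤ w z :=
  (abs_nonneg _).trans (h 0 z)

section

variable [NeZero n]

/-- The transition operator of the Markov chain of load vectors: `step d φ L` is the expected value
of `φ` after one more random ball has been placed at loads `L`. Its power `step d ^ s` averages
over `s` further balls. -/
def step (d : ℕ) : ((ZMod n → ℕ) → ℝ) →ₗ[ℝ] ((ZMod n → ℕ) → ℝ) where
  toFun φ L := 𝔼 c : Probe n d, φ (place L c)
  map_add' φ ψ := by
    funext L
    exact expect_add_distrib _ _ _
  map_smul' a φ := by
    funext L
    simp [mul_expect]

theorem step_apply (φ : (ZMod n → ℕ) → ℝ) (L : ZMod n → ℕ) :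
    step d φ L = 𝔼 c : Probe n d, φ (place L c) := rfl

theorem step_pow_succ (s : ℕ) (φ : (ZMod n → ℕ) → ℝ) :
    (step d ^ (s + 1)) φ = step d ((step d ^ s) φ) := by
  rw [pow_succ', Module.End.mul_apply]

theorem step_mono {φ ψ : (ZMod n → ℕ) → ℝ} (h : φ ≤ ψ) : step d φ ≤ step d ψ :=
  fun _ => expect_le_expect fun _ _ => h _

theorem step_pow_mono (s : ℕ) {φ ψ : (ZMod n → ℕ) → ℝ} (h : φ ≤ ψ) :
    (step d ^ s) φ ≤ (step d ^ s) ψ := by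
  induction s with
  | zero => simpa using h
  | succ s ih => simpa only [step_pow_succ] using step_mono ih

theorem step_pow_fun_const (s : ℕ) (a : ℝ) :
    (step d ^ s) (fun _ : ZMod n → ℕ => a) = fun _ => a := by
  induction s with
  | zero => simp
  | succ s ih =>
    funext L
    rw [step_pow_succ, ih, step_apply, Fintype.expect_const]

theorem abs_step_le {φ : (ZMod n → ℕ) → ℝ} {a : ℝ} (h : ∀ L, |φ L| ≤ a) (L : ZMod n → ℕ) :
    |step d φ L| ≤ a := by
  refine (abs_expect_le _ _).trans ?_
  exact (expect_le_expect fun _ _ => h _).trans (Fintype.expect_const a).le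

theorem step_pow_translate (s : ℕ) (φ : (ZMod n → ℕ) → ℝ) (t : ZMod n) (L : ZMod n → ℕ) :
    (step d ^ s) (fun L => φ fun b => L (b + t)) L = (step d ^ s) φ fun b => L (b + t) := by
  induction s generalizing L with
  | zero => simp
  | succ s ih =>
    simp only [step_pow_succ, step_apply, ih]
    refine (Fintype.expect_equiv
      (⟨fun c => ⟨c.start + t, c.stride, c.rank⟩, fun c => ⟨c.start - t, c.stride, c.rank⟩,
        fun c => by ext <;> simp, fun c => by ext <;> simp⟩ : Probe n d ≃ Probe n d) _ _ ?_).symm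
    intro c
    rw [place_translate]
    rfl

/-- The increment bound after averaging over one ball: a surplus ball in `z` stays in `z` or moves
from there to another choice of the random ball. -/
def spread (d : ℕ) (w : ZMod n → ℝ) (z : ZMod n) : ℝ :=
  w z + 𝔼 c : Probe n d, ∑ k, ∑ l, if c.bin k = z ∧ z ≠ c.bin l then w (c.bin l) else 0

theorem IncrementLE.step_spread (hd : 1 ≤ d) {φ : (ZMod n → ℕ) → ℝ} {w : ZMod n → ℝ}
    (h : IncrementLE φ w) : IncrementLE (step d φ) (spread d w) := by
  intro L z
  rw [step_apply, step_apply, ← expect_sub_distrib, spread,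
    ← Fintype.expect_const (ι := Probe n d) (w z), ← expect_add_distrib]
  refine (abs_expect_le _ _).trans (expect_le_expect fun c _ => ?_)
  have hnn : ∀ k l, 0 ≤ if c.bin k = z ∧ z ≠ c.bin l then w (c.bin l) else 0 := by
    intro k l
    split_ifs
    · exact h.nonneg _
    · exact le_rfl
  obtain ⟨z', hz', hor⟩ := place_add_single hd c L z
  rw [hz']
  refine (h _ _).trans ?_
  rcases hor with rfl | ⟨k, l, hk, rfl, hne⟩
  · exact le_add_of_nonneg_right (sum_nonneg fun k _ => sum_nonneg fun l _ => hnn k l)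
  · refine le_trans ?_ (le_add_of_nonneg_left (h.nonneg z))
    calc w (c.bin l) = if c.bin k = z ∧ z ≠ c.bin l then w (c.bin l) else 0 := by
          rw [if_pos ⟨hk, hne⟩]
      _ ≤ ∑ l, if c.bin k = z ∧ z ≠ c.bin l then w (c.bin l) else 0 :=
          single_le_sum (f := fun l => if c.bin k = z ∧ z ≠ c.bin l then w (c.bin l) else 0)
            (fun l _ => hnn k l) (mem_univ l)
      _ ≤ _ := single_le_sum
            (f := fun k => ∑ l, if c.bin k = z ∧ z ≠ c.bin l then w (c.bin l) else 0)
            (fun k _ => sum_nonneg fun l _ => hnn k l) (mem_univ k)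

theorem IncrementLE.step_const (hd : 1 ≤ d) {φ : (ZMod n → ℕ) → ℝ} {a : ℝ}
    (h : IncrementLE φ fun _ => a) : IncrementLE (step d φ) fun _ => a := by
  intro L z
  rw [step_apply, step_apply, ← expect_sub_distrib]
  refine (abs_expect_le _ _).trans ((expect_le_expect fun c _ => ?_).trans
    (Fintype.expect_const (ι := Probe n d) a).le)
  obtain ⟨z', hz', -⟩ := place_add_single hd c L z
  rw [hz']
  exact h _ _

/-- The total influence grows by a factor `1 + d² / n` only, since a random ball hits a given bin
with probability at most `d / n`. -/
theorem sum_spread_le {w : ZMod n → ℝ} (hw : ∀ z, 0 ≤ w z) :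
    ∑ z, spread d w z ≤ (1 + d ^ 2 / n) * ∑ z, w z := by
  simp only [spread, sum_add_distrib]
  rw [← expect_sum_comm, add_mul, one_mul]
  gcongr
  have key : ∀ c : Probe n d,
      ∑ z, ∑ k, ∑ l, (if c.bin k = z ∧ z ≠ c.bin l then w (c.bin l) else 0)
        ≤ d * ∑ l, w (c.bin l) := by
    intro c
    rw [sum_comm]
    calc ∑ k : Fin d, ∑ z, ∑ l, (if c.bin k = z ∧ z ≠ c.bin l then w (c.bin l) else 0)
        ≤ ∑ k : Fin d, ∑ z, if c.bin k = z then ∑ l, w (c.bin l) else 0 := by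
          refine sum_le_sum fun k _ => sum_le_sum fun z _ => ?_
          by_cases hz : c.bin k = z
          · rw [if_pos hz]
            refine sum_le_sum fun l _ => ?_
            split_ifs
            · exact le_rfl
            · exact hw _
          · simp [hz]
      _ = d * ∑ l, w (c.bin l) := by simp
  refine (expect_le_expect fun c _ => key c).trans (le_of_eq ?_)
  rw [← mul_expect, expect_sum_bin]
  ring

/-- The influence on a single bin grows by little, since two given bins are rarely both hit. -/
theorem spread_le {w : ZMod n → ℝ} (hw : ∀ z, 0 ≤ w z) (z : ZMod n) :
    spread d w z ≤ w z + d ^ 3 / (n * n.totient) * ∑ z, w z := by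
  rw [spread]
  gcongr
  have key : ∀ c : Probe n d,
      ∑ k, ∑ l, (if c.bin k = z ∧ z ≠ c.bin l then w (c.bin l) else 0) =
      ∑ k, ∑ l, ∑ z', if z ≠ z' then
        (if c.bin k = z ∧ c.bin l = z' then (1 : ℝ) else 0) * w z' else 0 := by
    intro c
    refine sum_congr rfl fun k _ => sum_congr rfl fun l _ => ?_
    rw [sum_eq_single (c.bin l)]
    · by_cases h1 : c.bin k = z <;> by_cases h2 : z = c.bin l <;> simp [h1, h2]
    · intro b _ hb
      simp [hb.symm]
    · simp
  simp only [key]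
  rw [expect_sum_comm]
  have bound : ∀ k l : Fin d, 𝔼 c : Probe n d, ∑ z', (if z ≠ z' then
        (if c.bin k = z ∧ c.bin l = z' then (1 : ℝ) else 0) * w z' else 0)
      ≤ d / (n * n.totient) * ∑ z, w z := by
    intro k l
    rw [expect_sum_comm, mul_sum]
    refine sum_le_sum fun z' _ => ?_
    by_cases hz : z = z'
    · simp only [hz, ne_eq, not_true_eq_false, if_false, expect_const_zero]
      have := hw z'
      positivity
    · simp only [ne_eq, hz, not_false_eq_true, if_true]
      rw [← expect_mul]
      exact mul_le_mul_of_nonneg_right (expect_bin_pair_le k l hz) (hw z')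
  calc ∑ k : Fin d, 𝔼 c : Probe n d, ∑ l : Fin d, ∑ z', (if z ≠ z' then
        (if c.bin k = z ∧ c.bin l = z' then (1 : ℝ) else 0) * w z' else 0)
      ≤ ∑ k : Fin d, ∑ l : Fin d, d / (n * n.totient) * ∑ z, w z := by
        refine sum_le_sum fun k _ => ?_
        rw [expect_sum_comm]
        exact sum_le_sum fun l _ => bound k l
    _ = d ^ 3 / (n * n.totient) * ∑ z, w z := by
        simp only [sum_const, card_univ, Fintype.card_fin, nsmul_eq_mul]
        ring

/-- Increment bounds after averaging over `s` balls, in total over all bins and bin by bin. -/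
theorem IncrementLE.step_pow (hd : 1 ≤ d) {φ : (ZMod n → ℕ) → ℝ} {w : ZMod n → ℝ}
    (h : IncrementLE φ w) (s : ℕ) :
    ∃ w', IncrementLE ((step d ^ s) φ) w' ∧
      ∑ z, w' z ≤ (1 + d ^ 2 / n : ℝ) ^ s * ∑ z, w z ∧
      ∀ z, w' z ≤ w z + s * (d ^ 3 / (n * n.totient) * ((1 + d ^ 2 / n : ℝ) ^ s * ∑ z, w z)) := by
  induction s with
  | zero => exact ⟨w, by simpa using h, by simp, by simp⟩
  | succ s ih =>
    obtain ⟨w', h1, h2, h3⟩ := ih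
    have hS : 0 ≤ ∑ z, w z := sum_nonneg fun z _ => h.nonneg z
    have hq : (1 : ℝ) ≤ 1 + d ^ 2 / n := le_add_of_nonneg_right (by positivity)
    have hgrow : (1 + d ^ 2 / n : ℝ) ^ s * ∑ z, w z ≤ (1 + d ^ 2 / n : ℝ) ^ (s + 1) * ∑ z, w z := by
      gcongr
      exact Nat.le_succ s
    refine ⟨spread d w', ?_, ?_, fun z => ?_⟩
    · rw [step_pow_succ]
      exact h1.step_spread hd
    · refine (sum_spread_le h1.nonneg).trans ?_
      rw [pow_succ' _ s, mul_assoc]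
      gcongr
    · calc spread d w' z ≤ w' z + d ^ 3 / (n * n.totient) * ∑ z, w' z := spread_le h1.nonneg z
        _ ≤ (w z + s * (d ^ 3 / (n * n.totient) * ((1 + d ^ 2 / n : ℝ) ^ (s + 1) * ∑ z, w z)))
            + d ^ 3 / (n * n.totient) * ((1 + d ^ 2 / n : ℝ) ^ (s + 1) * ∑ z, w z) := by
          refine add_le_add ((h3 z).trans ?_) ?_
          · gcongr
          · gcongr
            exact h2.trans hgrow
        _ = _ := by push_cast; ring

theorem IncrementLE.step_pow_const (hd : 1 ≤ d) {φ : (ZMod n → ℕ) → ℝ} {a : ℝ}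
    (h : IncrementLE φ fun _ => a) (s : ℕ) : IncrementLE ((step d ^ s) φ) fun _ => a := by
  induction s with
  | zero => simpa using h
  | succ s ih =>
    rw [step_pow_succ]
    exact ih.step_const hd

/-! ### Covariances -/

theorem IncrementLE.expect_abs_le (hd : 1 ≤ d) {φ : (ZMod n → ℕ) → ℝ} {w : ZMod n → ℝ}
    (h : IncrementLE φ w) (L : ZMod n → ℕ) :
    𝔼 c : Probe n d, |φ (place L c) - φ L| ≤ d / n * ∑ z, w z := by
  rw [← expect_sum_bin]
  refine expect_le_expect fun c _ => ?_
  obtain ⟨k, hk⟩ := exists_selects hd c L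
  rw [hk.place_eq]
  exact (h _ _).trans (single_le_sum (f := fun k => w (c.bin k)) (fun k _ => h.nonneg _)
    (mem_univ k))

theorem IncrementLE.expect_abs_mul_le (hd : 1 ≤ d) {φ ψ : (ZMod n → ℕ) → ℝ} {w v : ZMod n → ℝ}
    (hφ : IncrementLE φ w) (hψ : IncrementLE ψ v) (L : ZMod n → ℕ) :
    𝔼 c : Probe n d, |(φ (place L c) - φ L) * (ψ (place L c) - ψ L)|
      ≤ d / n * ∑ z, w z * v z := by
  rw [← expect_sum_bin]
  refine expect_le_expect fun c _ => ?_
  obtain ⟨k, hk⟩ := exists_selects hd c L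
  rw [hk.place_eq, abs_mul]
  exact (mul_le_mul (hφ _ _) (hψ _ _) (abs_nonneg _) (hφ.nonneg _)).trans
    (single_le_sum (f := fun k => w (c.bin k) * v (c.bin k))
      (fun k _ => mul_nonneg (hφ.nonneg _) (hψ.nonneg _)) (mem_univ k))

/-- The covariance produced by one ball. -/
theorem IncrementLE.abs_step_mul_sub_le (hd : 1 ≤ d) {φ ψ : (ZMod n → ℕ) → ℝ}
    {w v : ZMod n → ℝ} (hφ : IncrementLE φ w) (hψ : IncrementLE ψ v) (L : ZMod n → ℕ) :
    |step d (φ * ψ) L - step d φ L * step d ψ L|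
      ≤ d / n * ∑ z, w z * v z + (d / n * ∑ z, w z) * (d / n * ∑ z, v z) := by
  set a : Probe n d → ℝ := fun c => φ (place L c) - φ L with ha
  set b : Probe n d → ℝ := fun c => ψ (place L c) - ψ L with hb
  have e1 : step d φ L = 𝔼 c, a c + φ L := by
    rw [ha, expect_sub_distrib, Fintype.expect_const, step_apply]
    ring
  have e2 : step d ψ L = 𝔼 c, b c + ψ L := by
    rw [hb, expect_sub_distrib, Fintype.expect_const, step_apply]
    ring
  have e3 : step d (φ * ψ) L = 𝔼 c, a c * b c + φ L * 𝔼 c, b c + ψ L * 𝔼 c, a c + φ L * ψ L := by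
    rw [step_apply, mul_expect, mul_expect, ← expect_add_distrib, ← expect_add_distrib,
      ← Fintype.expect_const (ι := Probe n d) (φ L * ψ L), ← expect_add_distrib]
    refine expect_congr rfl fun c _ => ?_
    simp only [ha, hb, Pi.mul_apply]
    ring
  have e : step d (φ * ψ) L - step d φ L * step d ψ L
      = 𝔼 c, a c * b c - (𝔼 c, a c) * 𝔼 c, b c := by
    rw [e1, e2, e3]
    ring
  rw [e]
  refine (abs_sub _ _).trans (add_le_add ?_ ?_)
  · exact (abs_expect_le _ _).trans (hφ.expect_abs_mul_le hd hψ L)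
  · rw [abs_mul]
    exact mul_le_mul ((abs_expect_le _ _).trans (hφ.expect_abs_le hd L))
      ((abs_expect_le _ _).trans (hψ.expect_abs_le hd L)) (abs_nonneg _)
      ((expect_nonneg fun _ _ => abs_nonneg _).trans (hφ.expect_abs_le hd L))

/-- The covariance after `s` balls is the accumulated effect of the single balls. -/
theorem abs_step_pow_mul_sub_le {φ ψ : (ZMod n → ℕ) → ℝ} {η : ℝ} (s : ℕ)
    (h : ∀ t < s, ∀ L, |step d ((step d ^ t) φ * (step d ^ t) ψ) L
      - step d ((step d ^ t) φ) L * step d ((step d ^ t) ψ) L| ≤ η) (L : ZMod n → ℕ) :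
    |(step d ^ s) (φ * ψ) L - (step d ^ s) φ L * (step d ^ s) ψ L| ≤ s * η := by
  induction s generalizing L with
  | zero => simp
  | succ s ih =>
    have h1 := abs_step_le (d := d)
      (φ := (step d ^ s) (φ * ψ) - (step d ^ s) φ * (step d ^ s) ψ)
      (fun L => ih (fun t ht => h t (by omega)) L) L
    have h2 := h s (by omega) L
    rw [map_sub, Pi.sub_apply] at h1
    rw [step_pow_succ, step_pow_succ, step_pow_succ]
    push_cast
    rw [add_mul, one_mul]
    refine le_trans (le_of_eq ?_) ((abs_add_le _ _).trans (add_le_add h1 h2))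
    congr 1
    ring

end

/-! ### Asymptotic independence of the loads -/

/-- The indicator that all bins in `A` have load at least `r`. -/
def allTail (r : ℕ) (A : Finset (ZMod n)) (L : ZMod n → ℕ) : ℝ :=
  ∏ b ∈ A, if r ≤ L b then 1 else 0

theorem allTail_nonneg (r : ℕ) (A : Finset (ZMod n)) (L : ZMod n → ℕ) : 0 ≤ allTail r A L :=
  prod_nonneg fun b _ => by split_ifs <;> norm_num

theorem allTail_le_one (r : ℕ) (A : Finset (ZMod n)) (L : ZMod n → ℕ) : allTail r A L ≤ 1 :=
  prod_le_one (fun b _ => by split_ifs <;> norm_num) fun b _ => by split_ifs <;> norm_num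

theorem allTail_empty (r : ℕ) : allTail r (∅ : Finset (ZMod n)) = fun _ => 1 := rfl

theorem allTail_singleton (r : ℕ) (b : ZMod n) (L : ZMod n → ℕ) :
    allTail r {b} L = if r ≤ L b then 1 else 0 := prod_singleton _ _

theorem allTail_insert (r : ℕ) {a : ZMod n} {A : Finset (ZMod n)} (ha : a ∉ A) :
    allTail r (insert a A) = allTail r A * allTail r {a} := by
  funext L
  rw [Pi.mul_apply, allTail_singleton, allTail, prod_insert ha, mul_comm, allTail]

theorem incrementLE_allTail (r : ℕ) (A : Finset (ZMod n)) :
    IncrementLE (allTail r A) fun z => if z ∈ A then 1 else 0 := by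
  intro L z
  dsimp only
  split_ifs with hz
  · have h1 := allTail_nonneg r A (L + Pi.single z 1)
    have h2 := allTail_le_one r A (L + Pi.single z 1)
    have h3 := allTail_nonneg r A L
    have h4 := allTail_le_one r A L
    rw [abs_le]
    constructor <;> linarith
  · have : allTail r A (L + Pi.single z 1) = allTail r A L := by
      refine prod_congr rfl fun b hb => ?_
      have : b ≠ z := fun h => hz (h ▸ hb)
      simp [this]
    rw [this, sub_self, abs_zero]

theorem allTail_image_bin (r : ℕ) (c : Probe n d) (L : ZMod n → ℕ) :
    allTail r (univ.image c.bin) L = if ∀ k, r ≤ L (c.bin k) then 1 else 0 := by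
  split_ifs with h
  · refine prod_eq_one fun b hb => ?_
    obtain ⟨k, -, rfl⟩ := mem_image.1 hb
    simp [h k]
  · push Not at h
    obtain ⟨k, hk⟩ := h
    exact prod_eq_zero (mem_image_of_mem _ (mem_univ k)) (by simp [hk])

theorem Probe.bin_injective (hn : d ≤ n) (c : Probe n d) : Function.Injective c.bin := by
  intro k l h
  simp only [Probe.bin, add_right_inj, Units.mul_left_inj] at h
  have := congrArg ZMod.val h
  rw [ZMod.val_natCast_of_lt (by omega), ZMod.val_natCast_of_lt (by omega)] at this
  exact Fin.ext this

section

variable [NeZero n]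

/-- The constant in the bound on covariances of loads of disjoint sets of bins. -/
def covConst (d : ℕ) (T : ℝ) : ℝ :=
  T ^ 2 * d ^ 6 * Real.exp (d ^ 2 * T) * (Real.exp (d ^ 2 * T) + 1)
    + T * d ^ 4 * Real.exp (d ^ 2 * T) ^ 2

theorem covConst_nonneg {T : ℝ} (hT : 0 ≤ T) : 0 ≤ covConst d T := by
  unfold covConst
  positivity

theorem totient_cast_pos : (0 : ℝ) < n.totient :=
  Nat.cast_pos.2 (Nat.totient_pos.2 (NeZero.pos n))

/-- Loads of disjoint sets of bins are almost uncorrelated. -/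
theorem abs_cov_allTail_le (hd : 1 ≤ d) {T : ℝ} (hT : 0 ≤ T) {s : ℕ} (hs : (s : ℝ) ≤ T * n)
    (r : ℕ) {A B : Finset (ZMod n)} (hA : #A ≤ d) (hB : #B ≤ d) (hAB : Disjoint A B)
    (L : ZMod n → ℕ) :
    |(step d ^ s) (allTail r A * allTail r B) L
      - (step d ^ s) (allTail r A) L * (step d ^ s) (allTail r B) L|
      ≤ covConst d T / n.totient := by
  have hn : (0 : ℝ) < n := Nat.cast_pos.2 (NeZero.pos n)
  have hφ : (0 : ℝ) < n.totient := totient_cast_pos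
  set M : ℝ := Real.exp (d ^ 2 * T) with hM
  have hM0 : 0 < M := Real.exp_pos _
  set β : ℝ := T * d ^ 4 * M / n.totient with hβ
  have hβ0 : 0 ≤ β := by positivity
  -- Increment bounds valid at all times up to `s`.
  have main : ∀ A : Finset (ZMod n), #A ≤ d → ∀ t < s, ∃ w,
      IncrementLE ((step d ^ t) (allTail r A)) w ∧ ∑ z, w z ≤ M * d ∧
        ∀ z, w z ≤ (if z ∈ A then 1 else 0) + β := by
    intro A hA t ht
    obtain ⟨w, h1, h2, h3⟩ := (incrementLE_allTail r A).step_pow hd t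
    have hsum : ∑ z, (if z ∈ A then (1 : ℝ) else 0) ≤ d := by
      simpa using hA
    have htT : (t : ℝ) ≤ T * n := le_trans (by exact_mod_cast ht.le) hs
    have hpow : (1 + d ^ 2 / n : ℝ) ^ t ≤ M := by
      calc (1 + d ^ 2 / n : ℝ) ^ t ≤ Real.exp (d ^ 2 / n) ^ t := by
            gcongr
            rw [add_comm]
            exact Real.add_one_le_exp _
        _ = Real.exp (t * (d ^ 2 / n)) := (Real.exp_nat_mul _ _).symm
        _ ≤ M := by
            rw [hM, Real.exp_le_exp]
            calc (t : ℝ) * (d ^ 2 / n) ≤ T * n * (d ^ 2 / n) := by gcongr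
              _ = d ^ 2 * T := by field_simp
    have hprod : (1 + d ^ 2 / n : ℝ) ^ t * ∑ z, (if z ∈ A then (1 : ℝ) else 0) ≤ M * d := by
      gcongr
    refine ⟨w, h1, h2.trans hprod, fun z => (h3 z).trans ?_⟩
    gcongr
    calc (t : ℝ) * (d ^ 3 / (n * n.totient)
          * ((1 + d ^ 2 / n : ℝ) ^ t * ∑ z, (if z ∈ A then (1 : ℝ) else 0)))
        ≤ T * n * (d ^ 3 / (n * n.totient) * (M * d)) := by gcongr
      _ = β := by rw [hβ]; field_simp
  set η : ℝ := d / n * (β * (M * d) + β * d) + (d / n * (M * d)) * (d / n * (M * d)) with hη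
  have hη0 : 0 ≤ η := by positivity
  refine (abs_step_pow_mul_sub_le s (η := η) (fun t ht L => ?_) L).trans ?_
  · obtain ⟨w, hw1, hw2, hw3⟩ := main A hA t ht
    obtain ⟨v, hv1, hv2, hv3⟩ := main B hB t ht
    refine (hw1.abs_step_mul_sub_le hd hv1 L).trans ?_
    have hw0 := sum_nonneg fun z (_ : z ∈ univ) => hw1.nonneg z
    have hv0 := sum_nonneg fun z (_ : z ∈ univ) => hv1.nonneg z
    -- The main terms of the two bounds have disjoint supports, so each product has a factor `β`.
    have hwv : ∑ z, w z * v z ≤ β * (M * d) + β * d := by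
      calc ∑ z, w z * v z ≤ ∑ z, (β * w z + β * if z ∈ B then 1 else 0) := by
            refine sum_le_sum fun z _ => ?_
            have e1 := mul_le_mul_of_nonneg_left (hv3 z) (hw1.nonneg z)
            have e2 := hw3 z
            by_cases hzB : z ∈ B
            · have hzA : z ∉ A := fun h => disjoint_left.1 hAB h hzB
              simp only [hzB, hzA, if_true, if_false] at e1 e2 ⊢
              linarith
            · simp only [hzB, if_false] at e1 ⊢
              linarith
        _ = β * ∑ z, w z + β * #B := by
            rw [sum_add_distrib, ← mul_sum, ← mul_sum]
            simp
        _ ≤ β * (M * d) + β * d := by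
            gcongr
    rw [hη]
    gcongr
  · calc (s : ℝ) * η ≤ T * n * η := by gcongr
      _ = T ^ 2 * d ^ 6 * M * (M + 1) / n.totient + T * d ^ 4 * M ^ 2 / n := by
          rw [hη, hβ]
          field_simp
      _ ≤ T ^ 2 * d ^ 6 * M * (M + 1) / n.totient + T * d ^ 4 * M ^ 2 / n.totient := by
          gcongr
          exact Nat.totient_le n
      _ = covConst d T / n.totient := by
          rw [covConst, add_div]

/-- The probability that a given bin has load at least `r` after `s` balls. -/
def tailProb (n d r s : ℕ) [NeZero n] : ℝ :=
  (step d ^ s) (allTail r {(0 : ZMod n)}) 0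

theorem step_pow_allTail_mem_Icc (r s : ℕ) (A : Finset (ZMod n)) (L : ZMod n → ℕ) :
    (step d ^ s) (allTail r A) L ∈ Set.Icc (0 : ℝ) 1 := by
  have h0 := step_pow_mono (d := d) s (φ := fun _ => 0) (ψ := allTail r A) (allTail_nonneg r A) L
  have h1 := step_pow_mono (d := d) s (φ := allTail r A) (ψ := fun _ => 1) (allTail_le_one r A) L
  rw [step_pow_fun_const] at h0 h1
  exact ⟨h0, h1⟩

theorem tailProb_mem_Icc (r s : ℕ) : tailProb n d r s ∈ Set.Icc (0 : ℝ) 1 :=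
  step_pow_allTail_mem_Icc r s _ _

theorem step_pow_allTail_singleton (r s : ℕ) (a : ZMod n) :
    (step d ^ s) (allTail r {a}) 0 = tailProb n d r s := by
  have h := step_pow_translate (d := d) s (allTail r {(0 : ZMod n)}) a 0
  have e : (fun L : ZMod n → ℕ => allTail r {0} fun b => L (b + a)) = allTail r {a} := by
    funext L
    simp [allTail_singleton]
  rw [e] at h
  exact h

/-- A bounded number of distinct bins have asymptotically independent loads. -/
theorem abs_step_pow_allTail_sub_le (hd : 1 ≤ d) {T : ℝ} (hT : 0 ≤ T) {s : ℕ}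
    (hs : (s : ℝ) ≤ T * n) (r : ℕ) (A : Finset (ZMod n)) (hA : #A ≤ d) :
    |(step d ^ s) (allTail r A) 0 - tailProb n d r s ^ #A|
      ≤ #A * (covConst d T / n.totient) := by
  induction A using Finset.induction_on with
  | empty => simp [allTail_empty, step_pow_fun_const]
  | insert a A ha ih =>
    rw [card_insert_of_notMem ha] at hA ⊢
    have h1 := ih (by omega)
    have h2 := abs_cov_allTail_le hd hT hs r (A := A) (B := {a}) (by omega) (by simpa using hd)
      (disjoint_singleton_right.2 ha) 0
    rw [step_pow_allTail_singleton] at h2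
    have hp := tailProb_mem_Icc (n := n) (d := d) r s
    have h3 : |((step d ^ s) (allTail r A) 0 - tailProb n d r s ^ #A) * tailProb n d r s|
        ≤ #A * (covConst d T / n.totient) := by
      rw [abs_mul, abs_of_nonneg hp.1]
      exact (mul_le_of_le_one_right (abs_nonneg _) hp.2).trans h1
    rw [allTail_insert r ha, pow_succ]
    push_cast
    rw [add_mul, one_mul, add_comm]
    refine le_trans (le_of_eq ?_) ((abs_add_le _ _).trans (add_le_add h2 h3))
    congr 1
    ring

/-! ### The drift and its mean-field approximation -/

/-- The probability that all choices of a random ball have load at least `r`. -/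
def allChoicesTail (d r : ℕ) (L : ZMod n → ℕ) : ℝ :=
  𝔼 c : Probe n d, allTail r (univ.image c.bin) L

/-- The fraction of bins of load at least `r`. -/
def fracTail (r : ℕ) (L : ZMod n → ℕ) : ℝ :=
  (∑ b, allTail r {b} L) / n

theorem step_pow_expect {ι : Type*} [Fintype ι] (s : ℕ) (f : ι → (ZMod n → ℕ) → ℝ)
    (L : ZMod n → ℕ) :
    (step d ^ s) (fun L => 𝔼 i, f i L) L = 𝔼 i, (step d ^ s) (f i) L := by
  induction s generalizing L with
  | zero => simp
  | succ s ih =>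
    simp only [step_pow_succ, step_apply, ih]
    exact expect_comm _ _ _

theorem abs_step_pow_allChoicesTail_sub_le (hd : 1 ≤ d) (hn : d ≤ n) {T : ℝ} (hT : 0 ≤ T) {s : ℕ}
    (hs : (s : ℝ) ≤ T * n) (r : ℕ) :
    |(step d ^ s) (allChoicesTail d r) (0 : ZMod n → ℕ) - tailProb n d r s ^ d|
      ≤ d * (covConst d T / n.totient) := by
  unfold allChoicesTail
  rw [step_pow_expect, ← Fintype.expect_const (ι := Probe n d) (tailProb n d r s ^ d),
    ← expect_sub_distrib]
  refine (abs_expect_le _ _).trans ((expect_le_expect fun c _ => ?_).trans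
    (Fintype.expect_const (ι := Probe n d) _).le)
  have hc : #(univ.image c.bin) = d := by
    rw [card_image_of_injective _ (c.bin_injective hn), card_univ, Fintype.card_fin]
  have h := abs_step_pow_allTail_sub_le hd hT hs r (univ.image c.bin) hc.le
  rwa [hc] at h

theorem step_pow_fracTail (r s : ℕ) :
    (step d ^ s) (fracTail r) (0 : ZMod n → ℕ) = tailProb n d r s := by
  have e : (fracTail r : (ZMod n → ℕ) → ℝ) = fun L => 𝔼 b : ZMod n, allTail r {b} L := by
    funext L
    rw [fracTail, Fintype.expect_eq_sum_div_card, ZMod.card]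
  rw [e, step_pow_expect]
  simp only [step_pow_allTail_singleton, Fintype.expect_const]

theorem incrementLE_allChoicesTail (r : ℕ) :
    IncrementLE (allChoicesTail d r : (ZMod n → ℕ) → ℝ) fun _ => d / n := by
  intro L z
  rw [allChoicesTail, allChoicesTail, ← expect_sub_distrib]
  refine (abs_expect_le _ _).trans ?_
  have h := expect_sum_bin (d := d) fun b : ZMod n => if b = z then (1 : ℝ) else 0
  rw [sum_ite_eq' univ z, if_pos (mem_univ z), mul_one] at h
  rw [← h]
  refine expect_le_expect fun c _ => (incrementLE_allTail r _ L z).trans ?_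
  have hnn : ∀ k, 0 ≤ if c.bin k = z then (1 : ℝ) else 0 := fun k => by split_ifs <;> norm_num
  dsimp only
  split_ifs with hz
  · obtain ⟨k, -, rfl⟩ := mem_image.1 hz
    refine le_trans ?_ (single_le_sum (fun l _ => by split_ifs <;> norm_num) (mem_univ k))
    simp
  · exact sum_nonneg fun k _ => hnn k

theorem incrementLE_fracTail (r : ℕ) :
    IncrementLE (fracTail r : (ZMod n → ℕ) → ℝ) fun _ => 1 / n := by
  intro L z
  rw [fracTail, fracTail, ← sub_div, ← sum_sub_distrib, abs_div, Nat.abs_cast]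
  refine div_le_div_of_nonneg_right ?_ (Nat.cast_nonneg n)
  refine (abs_sum_le_sum_abs _ _).trans ((sum_le_sum fun b _ =>
    incrementLE_allTail r {b} L z).trans ?_)
  simp

theorem fracTail_mem_Icc (r : ℕ) (L : ZMod n → ℕ) : fracTail r L ∈ Set.Icc (0 : ℝ) 1 := by
  have hn : (0 : ℝ) < n := Nat.cast_pos.2 (NeZero.pos n)
  refine ⟨div_nonneg (sum_nonneg fun b _ => allTail_nonneg _ _ _) hn.le, ?_⟩
  rw [fracTail, div_le_one hn]
  calc ∑ b : ZMod n, allTail r {b} L ≤ ∑ _b : ZMod n, (1 : ℝ) :=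
        sum_le_sum fun b _ => allTail_le_one _ _ _
    _ = n := by simp [ZMod.card]

/-- The variance after `s` balls of a functional that one ball changes by at most `a`. -/
theorem IncrementLE.step_pow_sq_sub_le (hd : 1 ≤ d) {φ : (ZMod n → ℕ) → ℝ} {a : ℝ}
    (h : IncrementLE φ fun _ => a) (s : ℕ) (L : ZMod n → ℕ) :
    (step d ^ s) (fun L' => (φ L' - (step d ^ s) φ L) ^ 2) L ≤ s * ((d + d ^ 2) * a ^ 2) := by
  have hn : (n : ℝ) ≠ 0 := Nat.cast_ne_zero.2 (NeZero.ne n)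
  set m := (step d ^ s) φ L with hm
  have e : (fun L' => (φ L' - m) ^ 2) = φ * φ - (2 * m) • φ + fun _ => m ^ 2 := by
    funext L'
    simp only [Pi.add_apply, Pi.sub_apply, Pi.mul_apply, Pi.smul_apply, smul_eq_mul]
    ring
  rw [e, map_add, map_sub, map_smul, step_pow_fun_const]
  have h2 := le_of_abs_le (abs_step_pow_mul_sub_le (d := d) (φ := φ) (ψ := φ)
    (η := (d + d ^ 2) * a ^ 2) s (fun t _ L => by
      have h3 := (h.step_pow_const hd t).abs_step_mul_sub_le hd (h.step_pow_const hd t) L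
      refine h3.trans (le_of_eq ?_)
      simp only [sum_const, card_univ, ZMod.card, nsmul_eq_mul]
      field_simp) L)
  simp only [Pi.add_apply, Pi.sub_apply, Pi.smul_apply, smul_eq_mul, ← hm] at h2 ⊢
  linarith

/-- The error made by treating the choices of a random ball as independent uniform bins. -/
def meanFieldError (d r : ℕ) (L : ZMod n → ℕ) : ℝ :=
  allChoicesTail d r L - fracTail r L ^ d

/-- The constant in the bound on the second moment of the mean-field error. -/
def errConst (d : ℕ) (T : ℝ) : ℝ :=
  3 * (T * ((d + d ^ 2) * d ^ 2) + (d * covConst d T) ^ 2 + d ^ 2 * (T * (d + d ^ 2)))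

theorem errConst_nonneg {T : ℝ} (hT : 0 ≤ T) : 0 ≤ errConst d T := by
  unfold errConst
  positivity

theorem abs_pow_sub_pow_le_mul {x y : ℝ} (hx : x ∈ Set.Icc (0 : ℝ) 1) (hy : y ∈ Set.Icc (0 : ℝ) 1)
    (d : ℕ) : |x ^ d - y ^ d| ≤ d * |x - y| := by
  refine (abs_pow_sub_pow_le x y d).trans ?_
  rw [abs_of_nonneg hx.1, abs_of_nonneg hy.1, mul_comm |x - y|]
  refine mul_le_of_le_one_right (by positivity) (pow_le_one₀ ?_ (max_le hx.2 hy.2))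
  exact hx.1.trans (le_max_left _ _)

theorem step_pow_meanFieldError_sq_le (hd : 1 ≤ d) (hn : d ≤ n) {T : ℝ} (hT : 0 ≤ T) {s : ℕ}
    (hs : (s : ℝ) ≤ T * n) (r : ℕ) :
    (step d ^ s) (fun L => meanFieldError d r L ^ 2) (0 : ZMod n → ℕ)
      ≤ errConst d T / n.totient := by
  have hn0 : (0 : ℝ) < n := Nat.cast_pos.2 (NeZero.pos n)
  have hφ : (0 : ℝ) < n.totient := totient_cast_pos
  have hφ1 : (1 : ℝ) ≤ n.totient := Nat.one_le_cast.2 (Nat.totient_pos.2 (NeZero.pos n))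
  have hφn : (n.totient : ℝ) ≤ n := Nat.cast_le.2 (Nat.totient_le n)
  set m := (step d ^ s) (allChoicesTail d r) (0 : ZMod n → ℕ) with hm
  set p := tailProb n d r s with hp
  have hmp := abs_step_pow_allChoicesTail_sub_le hd hn hT hs r
  have hV1 := (incrementLE_allChoicesTail (n := n) (d := d) r).step_pow_sq_sub_le hd s 0
  have hV2 := (incrementLE_fracTail (n := n) r).step_pow_sq_sub_le hd s 0
  rw [step_pow_fracTail] at hV2
  rw [← hm] at hV1 hmp
  rw [← hp] at hV2 hmp
  have hle : (fun L : ZMod n → ℕ => meanFieldError d r L ^ 2) ≤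
      (3 : ℝ) • (fun L => (allChoicesTail d r L - m) ^ 2) + (fun _ => 3 * (m - p ^ d) ^ 2)
        + (3 * d ^ 2 : ℝ) • (fun L => (fracTail r L - p) ^ 2) := by
    intro L
    simp only [Pi.add_apply, Pi.smul_apply, smul_eq_mul, meanFieldError]
    have h1 := abs_pow_sub_pow_le_mul (fracTail_mem_Icc r L)
      (tailProb_mem_Icc (n := n) (d := d) r s) d
    rw [← hp] at h1
    have h2 : (fracTail r L ^ d - p ^ d) ^ 2 ≤ d ^ 2 * (fracTail r L - p) ^ 2 := by
      rw [← mul_pow, sq_le_sq, abs_mul, Nat.abs_cast]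
      exact h1
    nlinarith [sq_nonneg ((allChoicesTail d r L - m) - (m - p ^ d)),
      sq_nonneg ((m - p ^ d) + (fracTail r L ^ d - p ^ d)),
      sq_nonneg ((allChoicesTail d r L - m) + (fracTail r L ^ d - p ^ d))]
  refine (step_pow_mono (d := d) s hle 0).trans ?_
  rw [map_add, map_add, map_smul, map_smul, step_pow_fun_const]
  simp only [Pi.add_apply, Pi.smul_apply, smul_eq_mul]
  have b1 : (s : ℝ) * ((d + d ^ 2) * (d / n) ^ 2) ≤ T * ((d + d ^ 2) * d ^ 2) / n.totient := by
    calc (s : ℝ) * ((d + d ^ 2) * (d / n) ^ 2) ≤ T * n * ((d + d ^ 2) * (d / n) ^ 2) := by gcongr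
      _ = T * ((d + d ^ 2) * d ^ 2) / n := by field_simp
      _ ≤ _ := by gcongr
  have b2 : (s : ℝ) * ((d + d ^ 2) * (1 / n) ^ 2) ≤ T * (d + d ^ 2) / n.totient := by
    calc (s : ℝ) * ((d + d ^ 2) * (1 / n) ^ 2) ≤ T * n * ((d + d ^ 2) * (1 / n) ^ 2) := by gcongr
      _ = T * (d + d ^ 2) / n := by field_simp
      _ ≤ _ := by gcongr
  have b3 : (m - p ^ d) ^ 2 ≤ (d * covConst d T) ^ 2 / n.totient := by
    have hC := covConst_nonneg (d := d) hT
    calc (m - p ^ d) ^ 2 ≤ (d * (covConst d T / n.totient)) ^ 2 := by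
          rw [sq_le_sq]
          exact hmp.trans (le_abs_self _)
      _ = (d * covConst d T) ^ 2 / n.totient ^ 2 := by ring
      _ ≤ _ := by
          gcongr
          exact le_self_pow₀ hφ1 (by norm_num)
  have b4 := mul_le_mul_of_nonneg_left (hV2.trans b2) (by positivity : (0 : ℝ) ≤ 3 * d ^ 2)
  rw [errConst]
  have b5 := hV1.trans b1
  refine le_trans (add_le_add (add_le_add (mul_le_mul_of_nonneg_left b5 (by norm_num))
    (mul_le_mul_of_nonneg_left b3 (by norm_num))) b4) (le_of_eq ?_)
  ring

theorem incrementLE_meanFieldError (r : ℕ) :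
    IncrementLE (meanFieldError d r : (ZMod n → ℕ) → ℝ) fun _ => 2 * d / n := by
  intro L z
  have h1 := incrementLE_allChoicesTail (n := n) (d := d) r L z
  have h2 := incrementLE_fracTail (n := n) r L z
  have h3 := abs_pow_sub_pow_le_mul (fracTail_mem_Icc r (L + Pi.single z 1))
    (fracTail_mem_Icc r L) d
  have h4 : (d : ℝ) * |fracTail r (L + Pi.single z 1) - fracTail r L| ≤ d * (1 / n) := by gcongr
  calc |meanFieldError d r (L + Pi.single z 1) - meanFieldError d r L|
      = |(allChoicesTail d r (L + Pi.single z 1) - allChoicesTail d r L)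
          - (fracTail r (L + Pi.single z 1) ^ d - fracTail r L ^ d)| := by
        congr 1
        simp only [meanFieldError]
        ring
    _ ≤ d / n + d * (1 / n) := (abs_sub _ _).trans (add_le_add h1 (h3.trans h4))
    _ = 2 * d / n := by ring

/-- The number of bins of load at least `i`. -/
def numTail (i : ℕ) (L : ZMod n → ℕ) : ℝ := ({b : ZMod n | i ≤ L b}.ncard : ℝ)

theorem numTail_eq_sum (i : ℕ) (L : ZMod n → ℕ) : numTail i L = ∑ b, allTail i {b} L := by
  classical
  simp only [allTail_singleton, sum_boole]
  rw [numTail, Set.ncard_eq_toFinset_card']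
  congr 2
  ext b
  simp

theorem fracTail_eq (i : ℕ) (L : ZMod n → ℕ) : fracTail i L = numTail i L / n := by
  rw [fracTail, numTail_eq_sum]

/-- The number of bins of load at least `i` grows by one exactly when the least load among the
choices is `i - 1`. -/
theorem numTail_place_sub (hd : 1 ≤ d) (i : ℕ) (c : Probe n d) (L : ZMod n → ℕ) :
    numTail i (place L c) - numTail i L
      = allTail (i - 1) (univ.image c.bin) L - allTail i (univ.image c.bin) L := by
  obtain ⟨k, hk⟩ := exists_selects hd c L
  have hall : ∀ r, (∀ l, r ≤ L (c.bin l)) ↔ r ≤ L (c.bin k) := fun r =>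
    ⟨fun h => h k, fun h l => h.trans (hk.le l)⟩
  rw [numTail_eq_sum, numTail_eq_sum, ← sum_sub_distrib, hk.place_eq, allTail_image_bin,
    allTail_image_bin, sum_eq_single (c.bin k)]
  · simp only [allTail_singleton, hall, Pi.add_apply, Pi.single_eq_same]
    simp only [Nat.sub_le_iff_le_add]
  · intro b _ hb
    simp [allTail_singleton, hb]
  · simp

/-- The error of the mean-field approximation to the drift of the number of bins of load at
least `i`. -/
theorem step_numTail_sub (hd : 1 ≤ d) (i : ℕ) (L : ZMod n → ℕ) :
    step d (numTail i) L - numTail i L - (fracTail (i - 1) L ^ d - fracTail i L ^ d)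
      = meanFieldError d (i - 1) L - meanFieldError d i L := by
  have h : step d (numTail i) L - numTail i L
      = allChoicesTail d (i - 1) L - allChoicesTail d i L := by
    rw [allChoicesTail, allChoicesTail, ← expect_sub_distrib, step_apply,
      ← Fintype.expect_const (ι := Probe n d) (numTail i L), ← expect_sub_distrib]
    exact expect_congr rfl fun c _ => numTail_place_sub hd i c L
  rw [h, meanFieldError, meanFieldError]
  ring

end

/-! ### The process of load vectors -/

theorem measurable_load [NeZero n] {Ω : Type*} (ball : ℕ → Ω → Probe n d) (m : ℕ) :
    Measurable[history ball m] fun ω => load (fun j => ball j ω) m := by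
  induction m with
  | zero => exact @measurable_const _ _ _ (history ball 0) _
  | succ m ih =>
    have h1 : Measurable[history ball (m + 1)] fun ω => load (fun j => ball j ω) m :=
      ih.mono (iSup₂_le fun j hj => le_iSup₂_of_le j (by omega) le_rfl) le_rfl
    have h2 : Measurable[history ball (m + 1)] (ball m) :=
      (comap_measurable (ball m)).mono (le_iSup₂_of_le m (by omega) le_rfl) le_rfl
    have h3 : Measurable fun p : (ZMod n → ℕ) × Probe n d => place p.1 p.2 := .of_discrete
    have h4 : Measurable[history ball (m + 1)]
        fun ω => (load (fun j => ball j ω) m, ball m ω) := h1.prodMk h2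
    exact h3.comp h4

section LoadChain

variable {Ω : Type*} [mΩ : MeasurableSpace Ω] {μ : Measure Ω} {ball : ℕ → Ω → Probe n d}

theorem IsDoubleHashing.history_le (h : IsDoubleHashing μ ball) (m : ℕ) :
    history ball m ≤ mΩ :=
  iSup₂_le fun j _ => (h.measurable j).comap_le

theorem load_le (c : ℕ → Probe n d) (m : ℕ) (b : ZMod n) : load c m b ≤ m := by
  induction m with
  | zero => exact le_rfl
  | succ m ih =>
    simp only [load, place]
    split_ifs <;> omega

theorem IsDoubleHashing.indep_history (h : IsDoubleHashing μ ball) (m : ℕ) :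
    Indep (MeasurableSpace.comap (ball m) inferInstance) (history ball m) μ := by
  have h1 := indep_iSup_of_disjoint (fun j => (h.measurable j).comap_le) h.indep.iIndep
    (S := {m}) (T := {j | j < m}) (by simp)
  simpa using h1

variable [NeZero n]

theorem IsDoubleHashing.measurable_comp_load (h : IsDoubleHashing μ ball)
    (φ : (ZMod n → ℕ) → ℝ) (m : ℕ) : Measurable fun ω => φ (load (fun j => ball j ω) m) :=
  (Measurable.of_discrete (f := φ)).comp ((measurable_load ball m).mono (h.history_le m) le_rfl)

theorem IsDoubleHashing.integrable_comp_load [IsFiniteMeasure μ] (h : IsDoubleHashing μ ball)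
    (φ : (ZMod n → ℕ) → ℝ) (m : ℕ) : Integrable (fun ω => φ (load (fun j => ball j ω) m)) μ := by
  -- Only finitely many load vectors are possible after `m` balls.
  obtain ⟨C, hC⟩ := ((Set.finite_Iic fun _ : ZMod n => m).image fun L => ‖φ L‖).bddAbove
  refine Integrable.of_bound (h.measurable_comp_load φ m).aestronglyMeasurable C
    (ae_of_all _ fun ω => hC ⟨_, ?_, rfl⟩)
  exact fun b => load_le _ m b

theorem IsDoubleHashing.measureReal_ball (h : IsDoubleHashing μ ball) (m : ℕ) (c : Probe n d) :
    μ.real (ball m ⁻¹' {c}) = (Fintype.card (Probe n d) : ℝ)⁻¹ := by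
  rw [measureReal_def, ← Measure.map_apply (h.measurable m) (measurableSet_singleton c),
    h.uniform m, uniformOn_univ, Measure.count_singleton]
  simp

/-- The load vectors form a Markov chain with transition operator `step d`. -/
theorem IsDoubleHashing.condExp_load_succ [IsProbabilityMeasure μ] (h : IsDoubleHashing μ ball)
    (φ : (ZMod n → ℕ) → ℝ) (m : ℕ) :
    μ[fun ω => φ (load (fun j => ball j ω) (m + 1)) | history ball m]
      =ᵐ[μ] fun ω => step d φ (load (fun j => ball j ω) m) := by
  classical
  set F : Probe n d → Ω → ℝ := fun c ω => φ (place (load (fun j => ball j ω) m) c) with hF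
  set G : Probe n d → Ω → ℝ := fun c => (ball m ⁻¹' {c}).indicator fun _ => 1 with hG
  have hmeas : ∀ c, MeasurableSet (ball m ⁻¹' {c}) := fun c =>
    h.measurable m (measurableSet_singleton c)
  have hGint : ∀ c, Integrable (G c) μ := fun c => (integrable_const 1).indicator (hmeas c)
  -- Splitting according to the value of the new ball, which is independent of the history.
  have hsum : (fun ω => φ (load (fun j => ball j ω) (m + 1))) = ∑ c, F c * G c := by
    funext ω
    rw [Finset.sum_apply, sum_eq_single (ball m ω)]
    · simp [hF, hG, load]
    · intro c _ hc
      simp [hG, Set.indicator, hc.symm]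
    · simp
  have hFGint : ∀ c, Integrable (F c * G c) μ := by
    intro c
    have : F c * G c = (ball m ⁻¹' {c}).indicator (F c) := by
      funext ω
      simp only [hG, Pi.mul_apply, Set.indicator]
      split_ifs <;> simp
    rw [this]
    exact (h.integrable_comp_load (fun L => φ (place L c)) m).indicator (hmeas c)
  have hterm : ∀ c, μ[F c * G c | history ball m]
      =ᵐ[μ] fun ω => F c ω * (Fintype.card (Probe n d) : ℝ)⁻¹ := by
    intro c
    have hFm : StronglyMeasurable[history ball m] (F c) :=
      ((Measurable.of_discrete (f := fun L : ZMod n → ℕ => φ (place L c))).comp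
        (measurable_load ball m)).stronglyMeasurable
    have hGm : StronglyMeasurable[MeasurableSpace.comap (ball m) inferInstance] (G c) :=
      (@stronglyMeasurable_const _ _ (MeasurableSpace.comap (ball m) inferInstance) _ 1).indicator
        ⟨{c}, measurableSet_singleton c, rfl⟩
    have h1 := condExp_mul_of_stronglyMeasurable_left hFm (hFGint c) (hGint c)
    have h2 := condExp_indep_eq (h.measurable m).comap_le (h.history_le m) hGm
      (h.indep_history m)
    filter_upwards [h1, h2] with ω e1 e2
    rw [e1, Pi.mul_apply, e2, hG, integral_indicator_const _ (hmeas c), h.measureReal_ball m c,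
      smul_eq_mul, mul_one]
  rw [hsum]
  refine (condExp_finsetSum (fun c _ => hFGint c) _).trans ?_
  filter_upwards [ae_all_iff.2 hterm] with ω hω
  rw [Finset.sum_apply, step_apply, Fintype.expect_eq_sum_div_card, div_eq_mul_inv, sum_mul]
  exact sum_congr rfl fun c _ => hω c

theorem IsDoubleHashing.integral_comp_load [IsProbabilityMeasure μ] (h : IsDoubleHashing μ ball)
    (φ : (ZMod n → ℕ) → ℝ) (m : ℕ) :
    ∫ ω, φ (load (fun j => ball j ω) m) ∂μ = (step d ^ m) φ 0 := by
  induction m generalizing φ with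
  | zero =>
    simp only [load, integral_const, probReal_univ, pow_zero, Module.End.one_apply, one_smul]
    rfl
  | succ m ih =>
    rw [← integral_condExp (h.history_le m), integral_congr_ae (h.condExp_load_succ φ m), ih,
      pow_succ, Module.End.mul_apply]

theorem tailFrac_eq_fracTail (c : ℕ → Probe n d) (i m : ℕ) :
    tailFrac c i m = fracTail i (load c m) := by
  rw [tailFrac, fracTail_eq]
  rfl

/-- The conditional drift differs from its mean-field approximation by the mean-field errors. -/
theorem IsDoubleHashing.condExp_sub_eq [IsProbabilityMeasure μ] (hd : 1 ≤ d)
    (h : IsDoubleHashing μ ball) (i m : ℕ) :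
    ∀ᵐ ω ∂μ, (μ[fun ω' => tailCount (fun j => ball j ω') i (m + 1)
          - tailCount (fun j => ball j ω') i m | history ball m]) ω
        - (tailFrac (fun j => ball j ω) (i - 1) m ^ d - tailFrac (fun j => ball j ω) i m ^ d)
      = meanFieldError d (i - 1) (load (fun j => ball j ω) m)
        - meanFieldError d i (load (fun j => ball j ω) m) := by
  have h1 := condExp_sub (h.integrable_comp_load (numTail i) (m + 1))
    (h.integrable_comp_load (numTail i) m) (history ball m)
  have h2 := h.condExp_load_succ (numTail i) m
  have h3 : μ[fun ω => numTail i (load (fun j => ball j ω) m) | history ball m]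
      = fun ω => numTail i (load (fun j => ball j ω) m) :=
    condExp_of_stronglyMeasurable (h.history_le m)
      ((Measurable.of_discrete (f := numTail i)).comp (measurable_load ball m)).stronglyMeasurable
      (h.integrable_comp_load (numTail i) m)
  filter_upwards [h1, h2] with ω e1 e2
  rw [← step_numTail_sub hd i, tailFrac_eq_fracTail, tailFrac_eq_fracTail, ← e2]
  rw [Pi.sub_apply, h3] at e1
  rw [← e1]
  rfl

end LoadChain

/-! ### Uniformity in time -/

/-- A sequence with small increments that is large once is large during a whole time window, so
that its sum of squares is large. -/
theorem le_sum_sq_of_lt_abs {D : ℕ → ℝ} {a lam : ℝ} (ha : 0 < a) (hlam : 0 < lam)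
    (hD : ∀ m, |D (m + 1) - D m| ≤ a) {m N : ℕ} (hm : 2 * lam < |D m|)
    (hN : m + ⌊lam / a⌋₊ < N) : lam ^ 3 / a ≤ ∑ k ∈ range N, D k ^ 2 := by
  have hwin : ∀ j : ℕ, |D (m + j) - D m| ≤ j * a := by
    intro j
    induction j with
    | zero => simp
    | succ j ih =>
      have e : D (m + (j + 1)) - D m = (D (m + j + 1) - D (m + j)) + (D (m + j) - D m) := by
        rw [add_assoc]
        ring
      rw [e]
      push_cast
      linarith [abs_add_le (D (m + j + 1) - D (m + j)) (D (m + j) - D m), hD (m + j)]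
  have hlow : ∀ j ∈ range (⌊lam / a⌋₊ + 1), lam ^ 2 ≤ D (m + j) ^ 2 := by
    intro j hj
    have hj' : (j : ℝ) * a ≤ lam := by
      rw [← le_div_iff₀ ha]
      exact (Nat.cast_le.2 (Nat.lt_succ_iff.1 (mem_range.1 hj))).trans
        (Nat.floor_le (by positivity))
    have h1 := hwin j
    have h2 := abs_sub_abs_le_abs_sub (D m) (D (m + j))
    rw [abs_sub_comm] at h2
    rw [sq_le_sq, abs_of_pos hlam]
    linarith
  calc lam ^ 3 / a = lam / a * lam ^ 2 := by ring
    _ ≤ (⌊lam / a⌋₊ + 1 : ℕ) * lam ^ 2 := by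
        gcongr
        push_cast
        exact (Nat.lt_floor_add_one _).le
    _ ≤ ∑ j ∈ range (⌊lam / a⌋₊ + 1), D (m + j) ^ 2 := by
        have := card_nsmul_le_sum _ _ _ hlow
        rwa [card_range, nsmul_eq_mul] at this
    _ = ∑ k ∈ Ico m (m + (⌊lam / a⌋₊ + 1)), D k ^ 2 := by
        rw [sum_Ico_eq_sum_range, Nat.add_sub_cancel_left]
    _ ≤ ∑ k ∈ range N, D k ^ 2 := by
        refine sum_le_sum_of_subset_of_nonneg (fun k hk => ?_) fun k _ _ => sq_nonneg _
        rw [mem_Ico] at hk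
        rw [mem_range]
        omega

/-- The mean-field errors are small at all times up to `T n` at once, with high probability. -/
theorem IsDoubleHashing.measureReal_lt_le [NeZero n] {Ω : Type*} [MeasurableSpace Ω]
    {μ : Measure Ω} [IsProbabilityMeasure μ] {ball : ℕ → Ω → Probe n d}
    (h : IsDoubleHashing μ ball) (hd : 1 ≤ d) (hn : d ≤ n) {T : ℝ} (hT : 0 ≤ T) (i : ℕ)
    {lam : ℝ} (hlam : 0 < lam) (hlam1 : lam ≤ 1) (hlamφ : lam ^ 4 * n.totient = 1) :
    1 - 16 * d * (T + 2) * errConst d (T + 1) * lam ≤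
      μ.real {ω | ∀ m : ℕ, (m : ℝ) ≤ T * n →
        |meanFieldError d (i - 1) (load (fun j => ball j ω) m)
          - meanFieldError d i (load (fun j => ball j ω) m)| ≤ 2 * lam} := by
  have hn0 : (0 : ℝ) < n := Nat.cast_pos.2 (NeZero.pos n)
  have hn1 : (1 : ℝ) ≤ n := Nat.one_le_cast.2 (NeZero.pos n)
  have hd0 : (1 : ℝ) ≤ d := Nat.one_le_cast.2 hd
  have hφ : (0 : ℝ) < n.totient := totient_cast_pos
  have hC := errConst_nonneg (d := d) (by linarith : 0 ≤ T + 1)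
  set E : (ZMod n → ℕ) → ℝ := fun L => meanFieldError d (i - 1) L - meanFieldError d i L with hE
  set a : ℝ := 4 * d / n with ha
  have ha0 : 0 < a := by positivity
  -- A window that starts before time `T n` ends before time `(T + 1) n`.
  set N : ℕ := ⌊(T + 1) * n⌋₊ + 1 with hN
  have hstep : ∀ (c : ℕ → Probe n d) m, |E (load c (m + 1)) - E (load c m)| ≤ a := by
    intro c m
    obtain ⟨k, hk⟩ := exists_selects hd (c m) (load c m)
    have e1 := incrementLE_meanFieldError (d := d) (i - 1) (load c m) ((c m).bin k)
    have e2 := incrementLE_meanFieldError (d := d) i (load c m) ((c m).bin k)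
    rw [load, hk.place_eq]
    calc |E (load c m + Pi.single ((c m).bin k) 1) - E (load c m)|
        = |(meanFieldError d (i - 1) (load c m + Pi.single ((c m).bin k) 1)
            - meanFieldError d (i - 1) (load c m))
          - (meanFieldError d i (load c m + Pi.single ((c m).bin k) 1)
            - meanFieldError d i (load c m))| := by
          congr 1
          simp only [hE]
          ring
      _ ≤ 2 * d / n + 2 * d / n := (abs_sub _ _).trans (add_le_add e1 e2)
      _ = a := by rw [ha]; ring
  have hmoment : ∀ m ∈ range N, ∫ ω, E (load (fun j => ball j ω) m) ^ 2 ∂μ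
      ≤ 4 * (errConst d (T + 1) / n.totient) := by
    intro m hm
    have hmT : (m : ℝ) ≤ (T + 1) * n :=
      (Nat.le_floor_iff (by positivity)).1 (Nat.lt_succ_iff.1 (mem_range.1 hm))
    rw [h.integral_comp_load (fun L => E L ^ 2)]
    have hle : (fun L => E L ^ 2) ≤ (2 : ℝ) • (fun L => meanFieldError d (i - 1) L ^ 2)
        + (2 : ℝ) • (fun L => meanFieldError d i L ^ 2) := by
      intro L
      simp only [hE, Pi.add_apply, Pi.smul_apply, smul_eq_mul]
      nlinarith [sq_nonneg (meanFieldError d (i - 1) L + meanFieldError d i L)]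
    refine (step_pow_mono (d := d) m hle 0).trans ?_
    rw [map_add, map_smul, map_smul]
    simp only [Pi.add_apply, Pi.smul_apply, smul_eq_mul]
    linarith [step_pow_meanFieldError_sq_le hd hn (by linarith) hmT i,
      step_pow_meanFieldError_sq_le hd hn (by linarith) hmT (i - 1)]
  have hint : ∀ m ∈ range N, Integrable (fun ω => E (load (fun j => ball j ω) m) ^ 2) μ :=
    fun m _ => h.integrable_comp_load (fun L => E L ^ 2) m
  have hNle : (N : ℝ) ≤ (T + 2) * n := by
    rw [hN]
    push_cast
    linarith [Nat.floor_le (by positivity : 0 ≤ (T + 1) * n)]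
  set S : Set Ω := {ω | lam ^ 3 / a ≤ ∑ m ∈ range N, E (load (fun j => ball j ω) m) ^ 2} with hS
  have hSm : MeasurableSet S := measurableSet_le measurable_const
    (Finset.measurable_sum _ fun m _ => h.measurable_comp_load (fun L => E L ^ 2) m)
  have hSle : μ.real S ≤ 16 * d * (T + 2) * errConst d (T + 1) * lam := by
    have h1 := mul_meas_ge_le_integral_of_nonneg
      (ae_of_all μ fun ω => sum_nonneg fun m (_ : m ∈ range N) =>
        sq_nonneg (E (load (fun j => ball j ω) m))) (integrable_finsetSum _ hint) (lam ^ 3 / a)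
    rw [integral_finsetSum _ hint] at h1
    have h2 := sum_le_card_nsmul _ _ _ hmoment
    rw [card_range, nsmul_eq_mul] at h2
    have h3 : (N : ℝ) * (4 * (errConst d (T + 1) / n.totient))
        ≤ (T + 2) * n * (4 * (errConst d (T + 1) / n.totient)) := by gcongr
    have h4 : (T + 2) * n * (4 * (errConst d (T + 1) / n.totient))
        = lam ^ 3 / a * (16 * d * (T + 2) * errConst d (T + 1) * lam) := by
      rw [ha]
      field_simp
      linear_combination (-16 * errConst d (T + 1)) * hlamφ
    exact le_of_mul_le_mul_left (((h1.trans h2).trans h3).trans h4.le) (by positivity)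
  calc 1 - 16 * d * (T + 2) * errConst d (T + 1) * lam ≤ 1 - μ.real S := by linarith
    _ = μ.real Sᶜ := (probReal_compl_eq_one_sub hSm).symm
    _ ≤ _ := by
      refine measureReal_mono fun ω hω m hm => ?_
      by_contra! hlt
      refine hω (le_sum_sq_of_lt_abs (D := fun m => E (load (fun j => ball j ω) m)) ha0 hlam
        (fun m => hstep _ m) hlt ?_)
      rw [hN, Nat.lt_succ_iff, Nat.le_floor_iff (by positivity)]
      push_cast
      have h1 : (⌊lam / a⌋₊ : ℝ) ≤ n := by
        refine (Nat.floor_le (by positivity)).trans ?_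
        rw [ha, div_div_eq_mul_div, div_le_iff₀ (by positivity)]
        nlinarith
      linarith

end DoubleHashing

end
theorem mainTheorem3 (d i : ℕ) (hd : 1 ≤ d) (hi : 1 ≤ i) (T : ℝ) (hT : 0 < T) :
    ∃ ε δ : ℕ → ℝ, Tendsto ε atTop (𝓝 0) ∧ Tendsto δ atTop (𝓝 0) ∧
      ∀ n : ℕ, 2 ≤ n →
      ∀ (Ω : Type*) [MeasurableSpace Ω] (μ : Measure Ω) [IsProbabilityMeasure μ]
        (ball : ℕ → Ω → DoubleHashing.Probe n d), DoubleHashing.IsDoubleHashing μ ball →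
        1 - δ n ≤ μ.real {ω | ∀ m : ℕ, (m : ℝ) ≤ T * n →
          |(μ[fun ω' => DoubleHashing.tailCount (fun j => ball j ω') i (m + 1)
                - DoubleHashing.tailCount (fun j => ball j ω') i m
              | DoubleHashing.history ball m]) ω
            - (DoubleHashing.tailFrac (fun j => ball j ω) (i - 1) m ^ d
                - DoubleHashing.tailFrac (fun j => ball j ω) i m ^ d)| ≤ ε n} := by
  set lam : ℕ → ℝ := fun n => (n.totient : ℝ) ^ (-(1 / 4) : ℝ) with hlam
  have hlim : Tendsto lam atTop (𝓝 0) :=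
    (tendsto_rpow_neg_atTop (by norm_num)).comp
      (tendsto_natCast_atTop_atTop.comp DoubleHashing.tendsto_totient_atTop)
  set C : ℝ := 16 * d * (T + 2) * DoubleHashing.errConst d (T + 1) with hC
  -- For `n < d` the choices of a ball may coincide, and the bound is trivial with `δ n = 1`.
  refine ⟨fun n => 2 * lam n, fun n => if n < d then 1 else C * lam n, ?_, ?_, ?_⟩
  · simpa using hlim.const_mul 2
  · have h : Tendsto (fun n => C * lam n) atTop (𝓝 0) := by simpa using hlim.const_mul C
    refine h.congr' ?_
    filter_upwards [eventually_ge_atTop d] with n hn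
    rw [if_neg (not_lt.2 hn)]
  intro n hn Ω _ μ _ ball h
  have : NeZero n := ⟨by omega⟩
  dsimp only
  split_ifs with hnd
  · rw [sub_self]
    exact measureReal_nonneg
  have hφ1 : (1 : ℝ) ≤ n.totient := Nat.one_le_cast.2 (Nat.totient_pos.2 (by omega))
  have hφ0 : (0 : ℝ) < n.totient := by linarith
  have hpow : lam n ^ 4 * n.totient = 1 := by
    rw [hlam]
    dsimp only
    rw [← Real.rpow_natCast, ← Real.rpow_mul hφ0.le]
    norm_num
    rw [Real.rpow_neg_one, inv_mul_cancel₀ hφ0.ne']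
  refine (h.measureReal_lt_le hd (not_lt.1 hnd) hT.le i (Real.rpow_pos_of_pos hφ0 _)
    (Real.rpow_le_one_of_one_le_of_nonpos hφ1 (by norm_num)) hpow).trans ?_
  refine ENNReal.toReal_mono (measure_ne_top _ _) (measure_mono_ae ?_)
  filter_upwards [ae_all_iff.2 (h.condExp_sub_eq hd i)] with ω hω hgood m hm
  rw [hω m]
  exact hgood m hm
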